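/- Let $D$ be a nonzero (associative, unital, not necessarily commutative) ring with centre $Z(D)$, let $n\ge 3$, and let $q_{ij}\in Z(D)$, $a_{ij,k}\in D$, $b_{ij}\in D$ be given for $1\le j<i\le n$ and $1\le k\le n$. The bi-quadratic algebra $A=D[x_1,\dots,x_n;Q,\mathbb A,\mathbb B]$ is the ring generated by the ring $D$ and elements $x_1,\dots,x_n$ subject to the defining relations $$x_i d = d x_i\quad (d\in D,\ 1\le i\le n),\qquad x_ix_j-q_{ij}x_jx_i=\sum_{l=1}^n a_{ij,l}x_l+b_{ij}\quad (j<i).$$ For $\alpha\in\mathbb N^n$ and $\sigma\in S_n$ put $x_\sigma^\alpha=x_{\sigma(1)}^{\alpha_1}\cdots x_{\sigma(n)}^{\alpha_n}$ and $x^\alpha=x_{\mathrm{id}}^\alpha=x_1^{\alpha_1}\cdots x_n^{\alpha_n}$. We write $A=\bigoplus_\alpha Dx_\sigma^\alpha$ when the elements $x_\sigma^\alpha$ $(\alpha\in\mathbb N^n)$ form a basis of $A$ as a left $D$-module. The relations are called consistent if $A\neq 0$. For $i<j<k$ the product $x_kx_jx_i$ can be simplified in exactly two ways by formally replacing subwords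 $x_sx_t$ $(t<s)$ by $q_{st}x_tx_s+\sum_l a_{st,l}x_l+b_{st}$, where coefficients from $D$ are moved to the left past the variables, until only words $x_{i_1}\cdots x_{i_m}$ with $i_1\le\dots\le i_m$ occur. The results have the form $$q_{kj}q_{ki}q_{ji}\,x_ix_jx_k+\sum_{|\alpha|\le 2}c_{k,j,i,\alpha}x^\alpha\qquad\text{and}\qquad q_{kj}q_{ki}q_{ji}\,x_ix_jx_k+\sum_{|\alpha|\le 2}c'_{k,j,i,\alpha}x^\alpha ,$$ where $c_{k,j,i,\alpha}\in D$ (resp. $c'_{k,j,i,\alpha}\in D$) are the coefficients obtained when one starts by replacing $x_kx_j$ (resp. $x_jx_i$). **Theorem.** The relations are consistent and $A=\bigoplus_{\alpha\in\mathbb N^n}Dx^\alpha$ if and only if all the elements $a_{ij,k}$ and $b_{ij}$ $(j<i)$ lie in $Z(D)$ and $$c_{k,j,i,\alpha}=c'_{k,j,i,\alpha}\qquad\text{for all } i<j<k \text{ and all } \alpha .$$ If these conditions hold and, in addition, all the elements $q_{ij}$ $(j<i)$ are units of $D$, then $A=\bigoplus_{\alpha\in\mathbb N^n}Dx_\sigma^\alpha$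 for every $\sigma\in S_n$. -/

import Mathlib

/-- The data `(Q, 𝔸, 𝔹)` of a bi-quadratic algebra in `n` variables over a ring `D`.
Only the entries with `j < i` (the lower triangular half-matrices) are ever used. -/
structure BiquadraticData (D : Type*) [Ring D] (n : ℕ) where
  q : Fin n → Fin n → D
  a : Fin n → Fin n → Fin n → D
  b : Fin n → Fin n → D
  q_central : ∀ i j, j < i → q i j ∈ Subring.center D

namespace BiquadraticData

variable {D : Type*} [Ring D] {n : ℕ} (P : BiquadraticData D n)

/-- The generator of the free ring attached to an element of `D`. -/
noncomputable def genC (n : ℕ) (d : D) : FreeAlgebra ℤ (D ⊕ Fin n) :=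
  FreeAlgebra.ι ℤ (Sum.inl d)

/-- The generator of the free ring attached to the variable `x_i`. -/
noncomputable def genX (D : Type*) {n : ℕ} (i : Fin n) : FreeAlgebra ℤ (D ⊕ Fin n) :=
  FreeAlgebra.ι ℤ (Sum.inr i)

/-- The defining relations: the relations of the ring `D`, the commutation `x_i d = d x_i`, and
`x_i x_j - q_{ij} x_j x_i = ∑_k a_{ij,k} x_k + b_{ij}` for `j < i`. -/
inductive Rel : FreeAlgebra ℤ (D ⊕ Fin n) → FreeAlgebra ℤ (D ⊕ Fin n) → Prop
  | one : Rel (genC n 1) 1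
  | add (d e : D) : Rel (genC n (d + e)) (genC n d + genC n e)
  | mul (d e : D) : Rel (genC n (d * e)) (genC n d * genC n e)
  | comm (i : Fin n) (d : D) : Rel (genX D i * genC n d) (genC n d * genX D i)
  | quad (i j : Fin n) (h : j < i) :
      Rel (genX D i * genX D j - genC n (P.q i j) * (genX D j * genX D i))
        (∑ k, genC n (P.a i j k) * genX D k + genC n (P.b i j))

/-- The bi-quadratic algebra `D[x_1, …, x_n; Q, 𝔸, 𝔹]`: the ring generated by the ring `D` and
`x_1, …, x_n` subject to the defining relations. -/
def Alg : Type _ := RingQuot P.Rel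

noncomputable instance : Ring P.Alg := inferInstanceAs (Ring (RingQuot P.Rel))

/-- The quotient map from the free ring. -/
noncomputable def proj : FreeAlgebra ℤ (D ⊕ Fin n) →+* P.Alg := RingQuot.mkRingHom P.Rel

theorem proj_rel {u v : FreeAlgebra ℤ (D ⊕ Fin n)} (h : P.Rel u v) : P.proj u = P.proj v :=
  RingQuot.mkRingHom_rel h

/-- The canonical ring homomorphism `D → A` (not injective in general). -/
noncomputable def coeff : D →+* P.Alg where
  toFun d := P.proj (genC n d)
  map_one' := (P.proj_rel Rel.one).trans (map_one _)
  map_mul' d e := (P.proj_rel (Rel.mul d e)).trans (map_mul _ _ _)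
  map_add' d e := (P.proj_rel (Rel.add d e)).trans (map_add _ _ _)
  map_zero' := by
    have h := (P.proj_rel (Rel.add 0 0)).trans (map_add _ _ _)
    rw [add_zero] at h
    exact left_eq_add.mp h

/-- The generator `x_i` of `A`. -/
noncomputable def x (i : Fin n) : P.Alg := P.proj (genX D i)

/-- `A` as a left `D`-module: `d • u = d u`. -/
noncomputable instance : Module D P.Alg := Module.compHom P.Alg P.coeff

/-- The monomial `x_σ^α = x_{σ(1)}^{α_1} ⋯ x_{σ(n)}^{α_n}`. -/
noncomputable def mono (σ : Equiv.Perm (Fin n)) (α : Fin n → ℕ) : P.Alg :=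
  (List.ofFn fun i => P.x (σ i) ^ α i).prod

/-- `A = ⨁_α D x_σ^α`: the monomials `x_σ^α` form a basis of the left `D`-module `A`. -/
def HasPBWBasis (σ : Equiv.Perm (Fin n)) : Prop :=
  LinearIndependent D (P.mono σ) ∧ Submodule.span D (Set.range (P.mono σ)) = ⊤

/-- The formal monomial `1` (exponent `α = 0`) in the free left `D`-module on the exponents `α`. -/
noncomputable def e0 (D : Type*) [Ring D] (n : ℕ) : (Fin n → ℕ) →₀ D := Finsupp.single 0 1

/-- The formal monomial `x_p`. -/
noncomputable def e1 (D : Type*) [Ring D] {n : ℕ} (p : Fin n) : (Fin n → ℕ) →₀ D :=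
  Finsupp.single (Pi.single p 1) 1

/-- The formal ordered monomial `x_p x_r` (used for `p ≤ r`). -/
noncomputable def e2 (D : Type*) [Ring D] {n : ℕ} (p r : Fin n) : (Fin n → ℕ) →₀ D :=
  Finsupp.single (Pi.single p 1 + Pi.single r 1) 1

/-- The simplified form of `x_p x_r`, as a combination of ordered monomials. The word is already
ordered if `p ≤ r`; otherwise the relation for `x_p x_r` is applied once. -/
noncomputable def nf (p r : Fin n) : (Fin n → ℕ) →₀ D :=
  if r < p then P.q p r • e2 D r p + ∑ l, P.a p r l • e1 D l + P.b p r • e0 D n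
  else e2 D p r

/-- `P.cLeft k j i α` is the coefficient `c_{k,j,i,α}` (for `i < j < k`): all terms except
`q_{kj} q_{ki} q_{ji} x_i x_j x_k` that result when the simplification of `x_k x_j x_i`
starts with `x_k x_j`:
* `(x_k x_j) x_i = q_{kj} x_j x_k x_i + ∑_l a_{kj,l} x_l x_i + b_{kj} x_i`;
* `x_j (x_k x_i) = q_{ki} x_j x_i x_k + ∑_l a_{ki,l} x_j x_l + b_{ki} x_j`;
* `(x_j x_i) x_k = q_{ji} x_i x_j x_k + ∑_l a_{ji,l} x_l x_k + b_{ji} x_k`;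

after which every remaining word of length two is simplified. -/
noncomputable def cLeft (k j i : Fin n) : (Fin n → ℕ) →₀ D :=
  (∑ l, P.a k j l • P.nf l i + P.b k j • e1 D i)
    + P.q k j • ((∑ l, P.a k i l • P.nf j l + P.b k i • e1 D j)
      + P.q k i • (∑ l, P.a j i l • P.nf l k + P.b j i • e1 D k))

/-- `P.cRight k j i α` is the coefficient `c'_{k,j,i,α}` (for `i < j < k`): all terms except
`q_{kj} q_{ki} q_{ji} x_i x_j x_k` that result when the simplification of `x_k x_j x_i`
starts with `x_j x_i`:
* `x_k (x_j x_i) = q_{ji} x_k x_i x_j + ∑_l a_{ji,l} x_k x_l + b_{ji} x_k`;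
* `(x_k x_i) x_j = q_{ki} x_i x_k x_j + ∑_l a_{ki,l} x_l x_j + b_{ki} x_j`;
* `x_i (x_k x_j) = q_{kj} x_i x_j x_k + ∑_l a_{kj,l} x_i x_l + b_{kj} x_i`;

after which every remaining word of length two is simplified. -/
noncomputable def cRight (k j i : Fin n) : (Fin n → ℕ) →₀ D :=
  (∑ l, P.a j i l • P.nf k l + P.b j i • e1 D k)
    + P.q j i • ((∑ l, P.a k i l • P.nf l j + P.b k i • e1 D j)
      + P.q k i • (∑ l, P.a k j l • P.nf i l + P.b k j • e1 D i))

/-- The equalities `c_{k,j,i,α} = c'_{k,j,i,α}` for all `i < j < k` and all `α`. -/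
def CoeffsAgree : Prop :=
  ∀ i j k : Fin n, i < j → j < k → ∀ α : Fin n → ℕ, P.cLeft k j i α = P.cRight k j i α

/-- All the structure constants `a_{ij,k}` and `b_{ij}` are central in `D`. -/
def CentralCoeffs : Prop :=
  ∀ i j : Fin n, j < i →
    (∀ k, P.a i j k ∈ Subring.center D) ∧ P.b i j ∈ Subring.center D

end BiquadraticData

/-!
The relations are read as the rewriting rules `x_i x_j → q_{ij} x_j x_i + ∑_l a_{ij,l} x_l + b_{ij}`
for `j < i`. They decrease words in the shortlex order, so every word is a combination of ordered
monomials; the question is whether these are independent.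

If they are, then comparing coordinates in `x_i x_j d = d x_i x_j` shows that the structure constants
are central (`HasPBWBasis.centralCoeffs`), and comparing the two ways of rewriting `x_k x_j x_i` shows
that the coefficients agree (`HasPBWBasis.coeffsAgree`).

Conversely, each word `w` gets a normal form in the free left module on ordered monomials, by
recursion along the shortlex order with an arbitrary choice of descents (`normalForm`). The main point
is that the choice does not matter (`normalForm_eq_rewrite`). By shortlex induction it is enough to
compare two descents of the same word. Disjoint descents commute because the constants are central
(`CentralCoeffs.rewrite_comm`). Two overlapping descents form a factor `x_k x_j x_i` with
`i < j < k`, and the two results differ by `cLeft - cRight`, evaluated inside the surrounding word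
(`rewrite_left`, `rewrite_right`). Hence prepending `x_i` to words induces operators on the free module
that satisfy the defining relations (`opX_opX`). The algebra acts, and its orbit map at `1` sends the
ordered monomials to the standard basis (`hasPBWBasis_one`).

If moreover all `q_{ij}` are units, then permuting the letters of a word changes it by a unit factor
and by terms of lower degree (`exists_unit_of_perm`). So the monomials `x_σ^α` are triangular with
respect to the basis of ordered monomials, and form a basis themselves (`basis_of_triangular`).
-/

namespace BiquadraticData

variable {D : Type*} [Ring D] {n : ℕ} (P : BiquadraticData D n)

/-! ### Words and ordered words -/

/-- The word `x_{σ(1)}^{α_1} ⋯ x_{σ(n)}^{α_n}`, as a list of indices of variables. -/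
def expWord (σ : Equiv.Perm (Fin n)) (α : Fin n → ℕ) : List (Fin n) :=
  (List.ofFn fun i => List.replicate (α i) (σ i)).flatten

theorem count_expWord (σ : Equiv.Perm (Fin n)) (α : Fin n → ℕ) (i : Fin n) :
    (expWord σ α).count (σ i) = α i := by
  rw [expWord, List.count_flatten, List.map_ofFn, List.sum_ofFn]
  simp [List.count_replicate]

theorem length_expWord (σ : Equiv.Perm (Fin n)) (α : Fin n → ℕ) :
    (expWord σ α).length = ∑ i, α i := by
  rw [expWord, List.length_flatten, List.map_ofFn, List.sum_ofFn]
  simp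

theorem expWord_one_isChain (α : Fin n → ℕ) : (expWord 1 α).IsChain (· ≤ ·) := by
  rw [List.isChain_iff_pairwise, expWord, List.pairwise_flatten]
  constructor
  · intro l hl
    obtain ⟨i, rfl⟩ := List.mem_ofFn.mp hl
    simp [List.pairwise_replicate]
  · rw [List.pairwise_ofFn]
    intro i j hij x hx y hy
    rw [List.eq_of_mem_replicate hx, List.eq_of_mem_replicate hy]
    exact hij.le

/-- The exponent vector of a word. -/
def exponent (w : List (Fin n)) : Fin n → ℕ := fun i => w.count i

theorem exponent_expWord_one (α : Fin n → ℕ) : exponent (expWord 1 α) = α :=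
  funext fun i => count_expWord 1 α i

theorem expWord_exponent {w : List (Fin n)} (hw : w.IsChain (· ≤ ·)) :
    expWord 1 (exponent w) = w := by
  have hp : (expWord 1 (exponent w)).Perm w :=
    List.perm_iff_count.mpr fun i => count_expWord 1 (exponent w) i
  exact hp.eq_of_pairwise (fun _ _ _ _ h h' => le_antisymm h h')
    (List.isChain_iff_pairwise.mp (expWord_one_isChain _)) (List.isChain_iff_pairwise.mp hw)

theorem exists_descent {w : List (Fin n)} (hw : ¬ w.IsChain (· ≤ ·)) :
    ∃ (u : List (Fin n)) (i j : Fin n) (v : List (Fin n)), j < i ∧ w = u ++ i :: j :: v := by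
  rw [List.isChain_iff_forall_rel_of_append_cons_cons] at hw
  push Not at hw
  obtain ⟨i, j, u, v, rfl, h⟩ := hw
  exact ⟨u, i, j, v, h, rfl⟩

theorem not_isChain_of_descent {u v : List (Fin n)} {i j : Fin n} (h : j < i) :
    ¬ (u ++ i :: j :: v).IsChain (· ≤ ·) := by
  rw [List.isChain_append_cons_cons]
  exact fun h' => h.not_ge h'.2.1

theorem exponent_nil : exponent ([] : List (Fin n)) = 0 := by ext; simp [exponent]

theorem exponent_cons (p : Fin n) (w : List (Fin n)) :
    exponent (p :: w) = Pi.single p 1 + exponent w := by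
  ext i
  by_cases h : i = p
  · subst h; simp [exponent, add_comm]
  · simp [exponent, h, Ne.symm h]

theorem expWord_zero : expWord 1 (0 : Fin n → ℕ) = [] := by
  rw [← exponent_nil, expWord_exponent (by simp)]

theorem expWord_single (p : Fin n) : expWord 1 (Pi.single p 1) = [p] := by
  rw [← add_zero (Pi.single p 1 : Fin n → ℕ), ← exponent_nil, ← exponent_cons,
    expWord_exponent (by simp)]

theorem expWord_single_add_single {p r : Fin n} (h : p ≤ r) :
    expWord 1 (Pi.single p 1 + Pi.single r 1) = [p, r] := by
  rw [← add_zero (Pi.single r 1 : Fin n → ℕ), ← exponent_nil, ← exponent_cons, ← exponent_cons,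
    expWord_exponent (by simpa using h)]

/-- The shortlex order on words: shorter words come first, words of equal length are compared
lexicographically. Every application of a defining relation decreases words in this order. -/
abbrev WLT (w w' : List (Fin n)) : Prop := List.Shortlex (· < ·) w w'

theorem wlt_wf : WellFounded (WLT (n := n)) := List.Shortlex.wf wellFounded_lt

theorem wlt_append {s t : List (Fin n)} (h : WLT s t) (u v : List (Fin n)) :
    WLT (u ++ s ++ v) (u ++ t ++ v) := by
  rw [WLT, List.shortlex_def] at h ⊢
  rcases h with h | ⟨h, h'⟩
  · left; simpa using h
  · right
    refine ⟨by simpa using h, ?_⟩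
    rw [List.append_assoc, List.append_assoc]
    refine List.Lex.append_left _ ?_ u
    clear! u
    induction h' with
    | nil => simp at h
    | rel h' => exact .rel h'
    | cons _ ih => exact .cons (ih (by simpa using h))

theorem wlt_swap {i j : Fin n} (h : j < i) : WLT [j, i] [i, j] :=
  .of_lex rfl (.rel h)

theorem wlt_singleton (i j l : Fin n) : WLT [l] [i, j] := .of_length_lt (by simp)

theorem wlt_nil (i j : Fin n) : WLT [] [i, j] := .of_length_lt (by simp)

/-! ### Rewriting a descent -/

variable {N : Type*} [AddCommGroup N] [Module D N]

/-- The right-hand side `q_{ij} x_j x_i + ∑_l a_{ij,l} x_l + b_{ij}` of the relation for `x_i x_j`,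
with the words `x_j x_i`, `x_l`, `1` replaced by their values under a map `f`. -/
def rewrite (i j : Fin n) (f : List (Fin n) → N) : N :=
  P.q i j • f [j, i] + ∑ l, P.a i j l • f [l] + P.b i j • f []

theorem rewrite_congr {i j : Fin n} (h : j < i) {f g : List (Fin n) → N}
    (H : ∀ s, WLT s [i, j] → f s = g s) : P.rewrite i j f = P.rewrite i j g := by
  simp only [rewrite, H _ (wlt_swap h), H _ (wlt_singleton i j _), H _ (wlt_nil i j)]

theorem map_rewrite {N' : Type*} [AddCommGroup N'] [Module D N'] (g : N →ₗ[D] N') (i j : Fin n)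
    (f : List (Fin n) → N) : g (P.rewrite i j f) = P.rewrite i j (fun s => g (f s)) := by
  simp [rewrite]

theorem smul_smul_comm_of_center {c : D} (hc : c ∈ Subring.center D) (d : D) (m : N) :
    c • d • m = d • c • m := by
  rw [smul_smul, smul_smul, Subring.mem_center_iff.mp hc d]

variable {P} in
/-- Rewriting at two disjoint places can be done in either order. The coefficients of the
two relations then appear in opposite orders, so they have to commute. -/
theorem CentralCoeffs.rewrite_comm (hP : P.CentralCoeffs) {i j k l : Fin n} (hij : j < i)
    (f : List (Fin n) → List (Fin n) → N) :
    P.rewrite i j (fun s => P.rewrite k l (fun t => f s t)) =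
      P.rewrite k l (fun t => P.rewrite i j (fun s => f s t)) := by
  have hq : ∀ (d : D) (m : N), P.q i j • d • m = d • P.q i j • m :=
    fun d m => smul_smul_comm_of_center (P.q_central i j hij) d m
  have ha : ∀ (l) (d : D) (m : N), P.a i j l • d • m = d • P.a i j l • m :=
    fun l d m => smul_smul_comm_of_center ((hP i j hij).1 l) d m
  have hb : ∀ (d : D) (m : N), P.b i j • d • m = d • P.b i j • m :=
    fun d m => smul_smul_comm_of_center (hP i j hij).2 d m
  simp only [rewrite, smul_add, Finset.smul_sum, Finset.sum_add_distrib, hq, ha, hb]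
  rw [Finset.sum_comm]
  abel

/-- The value of a combination of ordered monomials under a map `F` on words. -/
noncomputable def evalOrdered (F : List (Fin n) → N) : ((Fin n → ℕ) →₀ D) →ₗ[D] N :=
  Finsupp.linearCombination D (fun α => F (expWord 1 α))

theorem evalOrdered_single (F : List (Fin n) → N) (α : Fin n → ℕ) (d : D) :
    evalOrdered F (Finsupp.single α d) = d • F (expWord 1 α) := by
  simp [evalOrdered]

theorem evalOrdered_e0 (F : List (Fin n) → N) : evalOrdered F (e0 D n) = F [] := by
  simp [e0, evalOrdered_single, expWord_zero]

theorem evalOrdered_e1 (F : List (Fin n) → N) (p : Fin n) : evalOrdered F (e1 D p) = F [p] := by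
  simp [e1, evalOrdered_single, expWord_single]

theorem evalOrdered_e2 (F : List (Fin n) → N) {p r : Fin n} (h : p ≤ r) :
    evalOrdered F (e2 D p r) = F [p, r] := by
  simp [e2, evalOrdered_single, expWord_single_add_single h]

variable {F : List (Fin n) → N}

variable {P} in
theorem evalOrdered_nf (h2 : ∀ p r, r < p → F [p, r] = P.rewrite p r F) (p r : Fin n) :
    evalOrdered F (P.nf p r) = F [p, r] := by
  unfold nf
  split_ifs with h
  · simp [evalOrdered_e0, evalOrdered_e1, evalOrdered_e2 F h.le, h2 p r h, rewrite]
  · exact evalOrdered_e2 F (not_lt.mp h)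

variable {P} in
/-- `cLeft` computes the result of rewriting `x_k x_j x_i` starting with `x_k x_j`: this holds for
every map on words that respects the rewriting steps involved. -/
theorem rewrite_left {i j k : Fin n}
    (h2 : ∀ p r, r < p → F [p, r] = P.rewrite p r F)
    (hki : F [j, k, i] = P.rewrite k i (fun s => F (j :: s)))
    (hji : F [j, i, k] = P.rewrite j i (fun s => F (s ++ [k]))) :
    P.rewrite k j (fun s => F (s ++ [i])) =
      (P.q k j * P.q k i * P.q j i) • F [i, j, k] + evalOrdered F (P.cLeft k j i) := by
  have e1 : P.rewrite k j (fun s => F (s ++ [i])) = P.q k j • F [j, k, i]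
    + ∑ l, P.a k j l • F [l, i] + P.b k j • F [i] := rfl
  have e2 : P.rewrite k i (fun s => F (j :: s)) = P.q k i • F [j, i, k]
    + ∑ l, P.a k i l • F [j, l] + P.b k i • F [j] := rfl
  have e3 : P.rewrite j i (fun s => F (s ++ [k])) = P.q j i • F [i, j, k]
    + ∑ l, P.a j i l • F [l, k] + P.b j i • F [k] := rfl
  rw [e1, hki, e2, hji, e3]
  simp only [cLeft, map_add, map_smul, map_sum, evalOrdered_nf h2, evalOrdered_e1, smul_add,
    mul_smul]
  abel

variable {P} in
/-- `cRight` computes the result of rewriting `x_k x_j x_i` starting with `x_j x_i`. -/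
theorem rewrite_right {i j k : Fin n} (hij : i < j) (hjk : j < k)
    (h2 : ∀ p r, r < p → F [p, r] = P.rewrite p r F)
    (hki : F [k, i, j] = P.rewrite k i (fun s => F (s ++ [j])))
    (hkj : F [i, k, j] = P.rewrite k j (fun s => F (i :: s))) :
    P.rewrite j i (fun s => F (k :: s)) =
      (P.q k j * P.q k i * P.q j i) • F [i, j, k] + evalOrdered F (P.cRight k j i) := by
  have e1 : P.rewrite j i (fun s => F (k :: s)) = P.q j i • F [k, i, j]
    + ∑ l, P.a j i l • F [k, l] + P.b j i • F [k] := rfl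
  have e2 : P.rewrite k i (fun s => F (s ++ [j])) = P.q k i • F [i, k, j]
    + ∑ l, P.a k i l • F [l, j] + P.b k i • F [j] := rfl
  have e3 : P.rewrite k j (fun s => F (i :: s)) = P.q k j • F [i, j, k]
    + ∑ l, P.a k j l • F [i, l] + P.b k j • F [i] := rfl
  have hc : P.q k j * P.q k i * P.q j i = P.q j i * (P.q k i * P.q k j) := by
    rw [← Subring.mem_center_iff.mp (P.q_central j i hij),
      Subring.mem_center_iff.mp (P.q_central k j hjk)]
  rw [e1, hki, e2, hkj, e3, hc]
  simp only [cRight, map_add, map_smul, map_sum, evalOrdered_nf h2, evalOrdered_e1, smul_add,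
    mul_smul]
  abel

/-! ### The normal form of a word -/

open Classical in
/-- The normal form of a word in the free left module on ordered monomials, obtained by rewriting
some descent and recursing along the shortlex order. The guard `WLT` always holds for the words
that occur in `rewrite`; it is there for the recursion only. -/
noncomputable def normalForm : List (Fin n) → ((Fin n → ℕ) →₀ D) :=
  wlt_wf.fix fun w ih =>
    if h : ∃ d : List (Fin n) × Fin n × Fin n × List (Fin n),
        d.2.2.1 < d.2.1 ∧ w = d.1 ++ d.2.1 :: d.2.2.1 :: d.2.2.2 then
      P.rewrite h.choose.2.1 h.choose.2.2.1 fun s =>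
        if hs : WLT (h.choose.1 ++ s ++ h.choose.2.2.2) w then ih _ hs else 0
    else Finsupp.single (exponent w) 1

theorem normalForm_of_isChain {w : List (Fin n)} (hw : w.IsChain (· ≤ ·)) :
    P.normalForm w = Finsupp.single (exponent w) 1 := by
  rw [normalForm, wlt_wf.fix_eq, dif_neg]
  rintro ⟨d, hd, rfl⟩
  exact not_isChain_of_descent hd hw

theorem exists_normalForm_eq_rewrite {w : List (Fin n)} (hw : ¬ w.IsChain (· ≤ ·)) :
    ∃ (u : List (Fin n)) (i j : Fin n) (v : List (Fin n)), j < i ∧ w = u ++ i :: j :: v ∧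
      P.normalForm w = P.rewrite i j (fun s => P.normalForm (u ++ s ++ v)) := by
  have h : ∃ d : List (Fin n) × Fin n × Fin n × List (Fin n),
      d.2.2.1 < d.2.1 ∧ w = d.1 ++ d.2.1 :: d.2.2.1 :: d.2.2.2 := by
    obtain ⟨u, i, j, v, h⟩ := exists_descent hw
    exact ⟨(u, i, j, v), h⟩
  refine ⟨h.choose.1, h.choose.2.1, h.choose.2.2.1, h.choose.2.2.2, h.choose_spec.1,
    h.choose_spec.2, ?_⟩
  rw [normalForm, wlt_wf.fix_eq, dif_pos h]
  refine P.rewrite_congr h.choose_spec.1 fun s hs => ?_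
  have := wlt_append hs h.choose.1 h.choose.2.2.2
  rw [dif_pos]
  conv_rhs => rw [h.choose_spec.2]
  simpa using this

variable {P} in
/-- Resolution of the overlap and disjointness ambiguities: if rewriting at any descent preserves
the normal form of all words smaller than `w`, then two descents of `w` give the same result. -/
theorem rewrite_eq_rewrite (hP : P.CentralCoeffs) (hc : P.CoeffsAgree) {w : List (Fin n)}
    (ih : ∀ (u : List (Fin n)) (i j : Fin n) (v : List (Fin n)), j < i →
      WLT (u ++ [i, j] ++ v) w →
      P.normalForm (u ++ [i, j] ++ v) = P.rewrite i j (fun s => P.normalForm (u ++ s ++ v)))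
    {u m v v' : List (Fin n)} {i j i' j' : Fin n} (h : j < i) (h' : j' < i')
    (hw : w = u ++ i :: j :: v) (hm : i :: j :: v = m ++ i' :: j' :: v') :
    P.rewrite i j (fun s => P.normalForm (u ++ s ++ v)) =
      P.rewrite i' j' (fun s => P.normalForm (u ++ m ++ s ++ v')) := by
  match m, hm with
  | [], hm =>
    obtain ⟨rfl, rfl, rfl⟩ : i = i' ∧ j = j' ∧ v = v' := by simpa using hm
    simp
  | [k], hm =>
    obtain ⟨rfl, rfl, rfl⟩ : i = k ∧ j = i' ∧ v = j' :: v' := by simpa using hm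
    -- the overlap `x_i x_j x_{j'}`
    let F : List (Fin n) → ((Fin n → ℕ) →₀ D) := fun s => P.normalForm (u ++ s ++ v')
    have hF : ∀ (a b : List (Fin n)) (p r : Fin n), r < p → WLT (a ++ [p, r] ++ b) [i, j, j'] →
        F (a ++ [p, r] ++ b) = P.rewrite p r (fun s => F (a ++ s ++ b)) := by
      intro a b p r hpr hlt
      have := ih (u ++ a) p r (b ++ v') hpr
        (by rw [hw]; simpa [List.append_assoc] using wlt_append hlt u v')
      simpa [F, List.append_assoc] using this
    have h2 : ∀ p r, r < p → F [p, r] = P.rewrite p r F := fun p r hpr => by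
      simpa using hF [] [] p r hpr (.of_length_lt (by simp))
    have hl := rewrite_left (i := j') (j := j) (k := i) h2
      (by simpa using hF [j] [] i j' (h'.trans h) (.of_lex rfl (.rel h)))
      (by simpa using hF [] [i] j j' h' (.of_lex rfl (.rel h)))
    have hr := rewrite_right h' h h2
      (by simpa using hF [] [j] i j' (h'.trans h) (.of_lex rfl (.cons (.rel h'))))
      (by simpa using hF [j'] [] i j h (.of_lex rfl (.rel (h'.trans h))))
    have hcc : P.cLeft i j j' = P.cRight i j j' := Finsupp.ext (hc j' j i h' h)
    rw [hcc, ← hr] at hl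
    simpa [F, List.append_assoc] using hl
  | k :: k' :: m, hm =>
    obtain ⟨rfl, rfl, rfl⟩ : i = k ∧ j = k' ∧ v = m ++ i' :: j' :: v' := by simpa using hm
    -- disjoint descents: rewriting one of them leaves the other one untouched
    have e1 : P.rewrite i j (fun s => P.normalForm (u ++ s ++ (m ++ i' :: j' :: v'))) =
        P.rewrite i j (fun s => P.rewrite i' j' (fun t =>
          P.normalForm (u ++ s ++ m ++ t ++ v'))) := by
      refine P.rewrite_congr h fun s hs => ?_
      have := ih (u ++ s ++ m) i' j' v' h' (by
        rw [hw]; simpa [List.append_assoc] using wlt_append hs u (m ++ i' :: j' :: v'))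
      simpa [List.append_assoc] using this
    have e2 : P.rewrite i' j' (fun t => P.normalForm (u ++ (i :: j :: m) ++ t ++ v')) =
        P.rewrite i' j' (fun t => P.rewrite i j (fun s =>
          P.normalForm (u ++ s ++ m ++ t ++ v'))) := by
      refine P.rewrite_congr h' fun t ht => ?_
      have := ih u i j (m ++ t ++ v') h (by
        rw [hw]; simpa [List.append_assoc] using wlt_append ht (u ++ i :: j :: m) v')
      simpa [List.append_assoc] using this
    rw [e1, e2, hP.rewrite_comm h]

variable {P} in
/-- Confluence: rewriting any descent of a word preserves its normal form. -/
theorem normalForm_eq_rewrite (hP : P.CentralCoeffs) (hc : P.CoeffsAgree) (u : List (Fin n))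
    {i j : Fin n} (h : j < i) (v : List (Fin n)) :
    P.normalForm (u ++ [i, j] ++ v) = P.rewrite i j (fun s => P.normalForm (u ++ s ++ v)) := by
  generalize hw : u ++ [i, j] ++ v = w
  induction w using wlt_wf.induction generalizing u i j v with
  | _ w ih =>
    have ih' : ∀ (u : List (Fin n)) (i j : Fin n) (v : List (Fin n)), j < i →
        WLT (u ++ [i, j] ++ v) w →
        P.normalForm (u ++ [i, j] ++ v) = P.rewrite i j (fun s => P.normalForm (u ++ s ++ v)) :=
      fun u i j v h hlt => ih _ hlt u h v rfl
    have hw' : w = u ++ i :: j :: v := by simp [← hw]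
    obtain ⟨u', i', j', v', h', hw'', e⟩ := P.exists_normalForm_eq_rewrite (w := w)
      (by rw [hw']; exact not_isChain_of_descent h)
    rw [e]
    rcases List.append_eq_append_iff.mp (hw'.symm.trans hw'') with ⟨m, rfl, hm⟩ | ⟨m, rfl, hm⟩
    · exact (rewrite_eq_rewrite hP hc ih' h h' hw' hm).symm
    · exact rewrite_eq_rewrite hP hc ih' h' h hw'' hm

/-! ### Words in the bi-quadratic algebra -/

theorem smul_def (d : D) (u : P.Alg) : d • u = P.coeff d * u := rfl

theorem x_mul_coeff (i : Fin n) (d : D) : P.x i * P.coeff d = P.coeff d * P.x i := by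
  have := P.proj_rel (Rel.comm i d)
  rwa [map_mul, map_mul] at this

theorem x_mul_x {i j : Fin n} (h : j < i) :
    P.x i * P.x j = P.q i j • (P.x j * P.x i) + ∑ l, P.a i j l • P.x l + P.b i j • 1 := by
  have := P.proj_rel (Rel.quad i j h)
  rw [map_sub, map_add, map_sum, sub_eq_iff_eq_add] at this
  simp only [map_mul] at this
  simp only [smul_def, mul_one]
  rw [add_assoc, add_comm]
  exact this

/-- The product of the variables along a word. -/
noncomputable def wordProd (w : List (Fin n)) : P.Alg := (w.map P.x).prod

theorem wordProd_nil : P.wordProd [] = 1 := rfl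

theorem wordProd_cons (i : Fin n) (w : List (Fin n)) :
    P.wordProd (i :: w) = P.x i * P.wordProd w := by simp [wordProd]

theorem wordProd_append (u v : List (Fin n)) :
    P.wordProd (u ++ v) = P.wordProd u * P.wordProd v := by simp [wordProd]

theorem mono_eq_wordProd (σ : Equiv.Perm (Fin n)) (α : Fin n → ℕ) :
    P.mono σ α = P.wordProd (expWord σ α) := by
  simp [mono, wordProd, expWord, List.map_flatten, List.prod_flatten, List.map_ofFn,
    Function.comp_def]

theorem wordProd_mul_coeff (w : List (Fin n)) (d : D) :
    P.wordProd w * P.coeff d = P.coeff d * P.wordProd w := by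
  induction w with
  | nil => simp [wordProd_nil]
  | cons i w ih => rw [wordProd_cons, mul_assoc, ih, ← mul_assoc, x_mul_coeff, mul_assoc]

theorem wordProd_mul_smul (w : List (Fin n)) (d : D) (u : P.Alg) :
    P.wordProd w * d • u = d • (P.wordProd w * u) := by
  rw [smul_def, smul_def, ← mul_assoc, wordProd_mul_coeff, mul_assoc]

theorem smul_mul (d : D) (u v : P.Alg) : (d • u) * v = d • (u * v) := by
  rw [smul_def, smul_def, mul_assoc]

theorem wordProd_eq_rewrite (u : List (Fin n)) {i j : Fin n} (h : j < i) (v : List (Fin n)) :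
    P.wordProd (u ++ [i, j] ++ v) = P.rewrite i j (fun s => P.wordProd (u ++ s ++ v)) := by
  have e : P.wordProd [i, j] = P.rewrite i j P.wordProd := by
    simp [rewrite, wordProd, P.x_mul_x h]
  simp only [wordProd_append, e]
  simp only [rewrite, mul_add, add_mul, Finset.mul_sum, Finset.sum_mul, wordProd_mul_smul, smul_mul]

theorem wordProd_pair (p r : Fin n) (h : r < p) :
    P.wordProd [p, r] = P.rewrite p r P.wordProd := by
  simpa using P.wordProd_eq_rewrite [] h []

theorem x_mul_smul (i : Fin n) (d : D) (u : P.Alg) : P.x i * d • u = d • (P.x i * u) := by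
  simpa [wordProd] using P.wordProd_mul_smul [i] d u

/-- The words span the algebra, because their span is a left ideal containing `1`. -/
theorem span_wordProd : Submodule.span D (Set.range P.wordProd) = ⊤ := by
  have key : ∀ (f : FreeAlgebra ℤ (D ⊕ Fin n)), ∀ s ∈ Submodule.span D (Set.range P.wordProd),
      P.proj f * s ∈ Submodule.span D (Set.range P.wordProd) := by
    intro f
    induction f using FreeAlgebra.induction with
    | grade0 z =>
      intro s hs
      rw [eq_intCast, map_intCast, ← zsmul_eq_mul]
      exact zsmul_mem hs z
    | grade1 t =>
      intro s hs
      rcases t with d | i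
      · exact Submodule.smul_mem _ d hs
      · change P.x i * s ∈ _
        induction hs using Submodule.span_induction with
        | mem s h =>
          obtain ⟨w, rfl⟩ := h
          exact Submodule.subset_span ⟨i :: w, P.wordProd_cons i w⟩
        | zero => simp
        | add s t _ _ hs ht => rw [mul_add]; exact add_mem hs ht
        | smul d s _ hs => rw [x_mul_smul]; exact Submodule.smul_mem _ d hs
    | mul f g hf hg => intro s hs; rw [map_mul, mul_assoc]; exact hf _ (hg _ hs)
    | add f g hf hg => intro s hs; rw [map_add, add_mul]; exact add_mem (hf _ hs) (hg _ hs)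
  rw [eq_top_iff]
  rintro a -
  obtain ⟨f, rfl⟩ := RingQuot.mkRingHom_surjective P.Rel a
  have := key f 1 (Submodule.subset_span ⟨[], rfl⟩)
  rwa [mul_one] at this

/-- The span of the ordered monomials of degree less than `m`. -/
noncomputable def degLT (m : ℕ) : Submodule D P.Alg :=
  Submodule.span D (P.mono 1 '' {α | ∑ i, α i < m})

/-- Rewriting never increases the length, so a word is a combination of ordered monomials of at most
its own degree. -/
theorem wordProd_mem_degLT (w : List (Fin n)) {m : ℕ} (hm : w.length < m) :
    P.wordProd w ∈ P.degLT m := by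
  induction w using wlt_wf.induction with
  | _ w ih =>
    by_cases hw : w.IsChain (· ≤ ·)
    · refine Submodule.subset_span ⟨exponent w, ?_, ?_⟩
      · rw [Set.mem_ofPred_eq, ← length_expWord 1, expWord_exponent hw]
        exact hm
      · rw [mono_eq_wordProd, expWord_exponent hw]
    · obtain ⟨u, i, j, v, h, rfl⟩ := exists_descent hw
      have e := P.wordProd_eq_rewrite u h v
      have hlt : ∀ s, WLT s [i, j] → P.wordProd (u ++ s ++ v) ∈ P.degLT m := by
        intro s hs
        have hs' := wlt_append hs u v
        rw [List.append_assoc u [i, j], List.cons_append, List.cons_append, List.nil_append] at hs'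
        refine ih _ hs' (lt_of_le_of_lt ?_ hm)
        rcases List.shortlex_def.mp hs' with h | h
        exacts [h.le, h.1.le]
      rw [List.append_assoc u [i, j], List.cons_append, List.cons_append, List.nil_append] at e
      rw [e, rewrite]
      refine add_mem (add_mem ?_ (sum_mem fun l _ => ?_)) ?_
      · exact Submodule.smul_mem _ _ (hlt _ (wlt_swap h))
      · exact Submodule.smul_mem _ _ (hlt _ (wlt_singleton i j l))
      · exact Submodule.smul_mem _ _ (hlt _ (wlt_nil i j))

theorem span_mono_one : Submodule.span D (Set.range (P.mono 1)) = ⊤ := by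
  rw [eq_top_iff, ← span_wordProd, Submodule.span_le]
  rintro _ ⟨w, rfl⟩
  exact Submodule.span_mono (Set.image_subset_range _ _)
    (P.wordProd_mem_degLT w (Nat.lt_succ_self _))

/-! ### The representation on ordered monomials -/

/-- The operator `x_i` on the free left module on ordered monomials: it sends `x^α` to the normal
form of `x_i x^α`. -/
noncomputable def opX (i : Fin n) : ((Fin n → ℕ) →₀ D) →ₗ[D] ((Fin n → ℕ) →₀ D) :=
  evalOrdered fun w => P.normalForm (i :: w)

variable {P}

/-- The operators `opX` prepend a letter to arbitrary words, not only to ordered ones. Confluence is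
what makes this possible. -/
theorem opX_normalForm (hP : P.CentralCoeffs) (hc : P.CoeffsAgree) (i : Fin n)
    (w : List (Fin n)) : P.opX i (P.normalForm w) = P.normalForm (i :: w) := by
  induction w using wlt_wf.induction with
  | _ w ih =>
    by_cases hw : w.IsChain (· ≤ ·)
    · rw [P.normalForm_of_isChain hw, opX, evalOrdered_single, one_smul, expWord_exponent hw]
    · obtain ⟨u, k, l, v, h, rfl⟩ := exists_descent hw
      have e1 := normalForm_eq_rewrite hP hc u h v
      have e2 := normalForm_eq_rewrite hP hc (i :: u) h v
      simp only [List.append_assoc, List.cons_append, List.nil_append] at e1 e2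
      rw [e1, e2, map_rewrite]
      refine P.rewrite_congr h fun s hs => ih _ ?_
      simpa using wlt_append hs u v

theorem opX_opX (hP : P.CentralCoeffs) (hc : P.CoeffsAgree) {i j : Fin n} (h : j < i)
    (m : (Fin n → ℕ) →₀ D) :
    P.opX i (P.opX j m) = P.q i j • P.opX j (P.opX i m) + ∑ l, P.a i j l • P.opX l m
      + P.b i j • m := by
  have hq : ∀ (d : D) (m : (Fin n → ℕ) →₀ D), P.q i j • d • m = d • P.q i j • m :=
    fun d m => smul_smul_comm_of_center (P.q_central i j h) d m
  have ha : ∀ (l) (d : D) (m : (Fin n → ℕ) →₀ D), P.a i j l • d • m = d • P.a i j l • m :=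
    fun l d m => smul_smul_comm_of_center ((hP i j h).1 l) d m
  have hb : ∀ (d : D) (m : (Fin n → ℕ) →₀ D), P.b i j • d • m = d • P.b i j • m :=
    fun d m => smul_smul_comm_of_center (hP i j h).2 d m
  induction m using Finsupp.induction_linear with
  | zero => simp
  | add f g hf hg =>
    simp only [map_add, hf, hg, smul_add, Finset.sum_add_distrib]
    abel
  | single α d =>
    have hα : Finsupp.single α d = d • P.normalForm (expWord 1 α) := by
      rw [P.normalForm_of_isChain (expWord_one_isChain α), exponent_expWord_one,
        Finsupp.smul_single, smul_eq_mul, mul_one]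
    have e := normalForm_eq_rewrite hP hc [] h (expWord 1 α)
    simp only [List.nil_append, List.cons_append, rewrite] at e
    rw [hα]
    simp only [map_smul, opX_normalForm hP hc, e, smul_add, Finset.smul_sum, hq, ha, hb]

/-- The action of the free ring on the free left module on ordered monomials: elements of `D` act by
left multiplication and the variables by `opX`. The endomorphisms are only `ℤ`-linear, since left
multiplication by an element of `D` need not be `D`-linear. -/
noncomputable def freeRep (P : BiquadraticData D n) :
    FreeAlgebra ℤ (D ⊕ Fin n) →+* Module.End ℤ ((Fin n → ℕ) →₀ D) :=
  (FreeAlgebra.lift ℤ (Sum.elim (fun d => Module.toModuleEnd ℤ ((Fin n → ℕ) →₀ D) d)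
    (fun i => (P.opX i).restrictScalars ℤ))).toRingHom

theorem freeRep_genC (d : D) (m : (Fin n → ℕ) →₀ D) : P.freeRep (genC n d) m = d • m := by
  simp [freeRep, genC]

theorem freeRep_genX (i : Fin n) (m : (Fin n → ℕ) →₀ D) :
    P.freeRep (genX D i) m = P.opX i m := by
  simp [freeRep, genX]

theorem freeRep_rel (hP : P.CentralCoeffs) (hc : P.CoeffsAgree) ⦃f g⦄ (h : P.Rel f g) :
    P.freeRep f = P.freeRep g := by
  refine LinearMap.ext fun m => ?_
  induction h with
  | one => rw [freeRep_genC, map_one, one_smul, Module.End.one_apply]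
  | add d e =>
    simp only [map_add, LinearMap.add_apply, freeRep_genC, add_smul]
  | mul d e =>
    rw [map_mul, Module.End.mul_apply]
    simp only [freeRep_genC, mul_smul]
  | comm i d =>
    simp only [map_mul, Module.End.mul_apply, freeRep_genC, freeRep_genX, map_smul]
  | quad i j h =>
    simp only [map_sub, map_add, map_mul, map_sum, LinearMap.sub_apply, LinearMap.add_apply,
      LinearMap.sum_apply, Module.End.mul_apply, freeRep_genC, freeRep_genX]
    rw [opX_opX hP hc h, add_assoc, add_sub_cancel_left]

/-- The action of the bi-quadratic algebra on the free left module on ordered monomials. -/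
noncomputable def rep (hP : P.CentralCoeffs) (hc : P.CoeffsAgree) :
    P.Alg →+* Module.End ℤ ((Fin n → ℕ) →₀ D) :=
  RingQuot.lift ⟨P.freeRep, freeRep_rel hP hc⟩

theorem rep_proj (hP : P.CentralCoeffs) (hc : P.CoeffsAgree) (f : FreeAlgebra ℤ (D ⊕ Fin n)) :
    rep hP hc (P.proj f) = P.freeRep f :=
  RingQuot.lift_mkRingHom_apply _ _ _

/-- The orbit map of `1 = x^0`. It is left `D`-linear and sends each word to its normal form. -/
noncomputable def toOrdered (hP : P.CentralCoeffs) (hc : P.CoeffsAgree) :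
    P.Alg →ₗ[D] ((Fin n → ℕ) →₀ D) where
  toFun u := rep hP hc u (e0 D n)
  map_add' u v := by rw [map_add]; rfl
  map_smul' d u := by
    rw [smul_def, map_mul, Module.End.mul_apply, RingHom.id_apply]
    change rep hP hc (P.proj (genC n d)) _ = _
    rw [rep_proj, freeRep_genC]

theorem toOrdered_wordProd (hP : P.CentralCoeffs) (hc : P.CoeffsAgree) (w : List (Fin n)) :
    toOrdered hP hc (P.wordProd w) = P.normalForm w := by
  induction w with
  | nil =>
    rw [P.normalForm_of_isChain (by simp), exponent_nil, wordProd_nil]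
    change rep hP hc 1 _ = _
    rw [map_one]; rfl
  | cons i w ih =>
    rw [wordProd_cons, ← opX_normalForm hP hc, ← ih]
    change rep hP hc (P.proj (genX D i) * _) _ = _
    rw [map_mul, Module.End.mul_apply, rep_proj, freeRep_genX]
    rfl

theorem hasPBWBasis_one (hP : P.CentralCoeffs) (hc : P.CoeffsAgree) : P.HasPBWBasis 1 := by
  refine ⟨LinearIndependent.of_comp (toOrdered hP hc) ?_, P.span_mono_one⟩
  have : toOrdered hP hc ∘ P.mono 1 = fun α => Finsupp.single α 1 := by
    funext α
    rw [Function.comp_apply, mono_eq_wordProd, toOrdered_wordProd,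
      P.normalForm_of_isChain (expWord_one_isChain α), exponent_expWord_one]
  rw [this]
  exact Finsupp.linearIndependent_single_one D _

/-! ### Necessity of the conditions -/

theorem evalOrdered_injective (h : P.HasPBWBasis 1) :
    Function.Injective (evalOrdered (D := D) P.wordProd) := by
  have e : (fun α => P.wordProd (expWord 1 α)) = P.mono 1 :=
    funext fun α => (P.mono_eq_wordProd 1 α).symm
  rw [evalOrdered, e]
  exact h.1

theorem evalOrdered_mul_coeff (m : (Fin n → ℕ) →₀ D) (d : D) :
    evalOrdered P.wordProd m * P.coeff d =
      evalOrdered P.wordProd (m.mapRange (· * d) (zero_mul d)) := by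
  induction m using Finsupp.induction_linear with
  | zero => simp
  | add f g hf hg => rw [map_add, add_mul, hf, hg, ← map_add, Finsupp.mapRange_add (add_mul · · d)]
  | single α c =>
    rw [Finsupp.mapRange_single, evalOrdered_single, evalOrdered_single, smul_def, smul_def,
      mul_assoc, wordProd_mul_coeff, map_mul, mul_assoc]

/-- The word `x_p x_r` commutes with the elements of `D`, hence so do its coordinates in the basis of
ordered monomials. -/
theorem nf_mem_center (h : P.HasPBWBasis 1) (p r : Fin n) (α : Fin n → ℕ) :
    P.nf p r α ∈ Subring.center D := by
  rw [Subring.mem_center_iff]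
  intro d
  have e : evalOrdered P.wordProd (d • P.nf p r) =
      evalOrdered P.wordProd ((P.nf p r).mapRange (· * d) (zero_mul d)) := by
    rw [← evalOrdered_mul_coeff, map_smul, evalOrdered_nf P.wordProd_pair, smul_def,
      wordProd_mul_coeff]
  simpa using DFunLike.congr_fun (evalOrdered_injective h e) α

theorem nf_apply_single {i j : Fin n} (h : j < i) (k : Fin n) :
    P.nf i j (Pi.single k 1) = P.a i j k := by
  have h2 : (Pi.single j 1 + Pi.single i 1 : Fin n → ℕ) ≠ Pi.single k 1 := fun e => by
    simpa [Finset.sum_add_distrib] using congrArg (fun α : Fin n → ℕ => ∑ i, α i) e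
  have h1 : ∀ l, (Pi.single l 1 : Fin n → ℕ) = Pi.single k 1 ↔ l = k := fun l =>
    ⟨fun e => by by_contra hl; simpa [hl] using congrFun e l, fun e => by rw [e]⟩
  simp [nf, h, e0, e1, e2, Finsupp.single_apply, h2, h1]

theorem nf_apply_zero {i j : Fin n} (h : j < i) : P.nf i j 0 = P.b i j := by
  have h2 : (Pi.single j 1 + Pi.single i 1 : Fin n → ℕ) ≠ 0 := fun e => by
    simpa [Finset.sum_add_distrib] using congrArg (fun α : Fin n → ℕ => ∑ i, α i) e
  have h1 : ∀ l, (Pi.single l 1 : Fin n → ℕ) ≠ 0 := fun l e => by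
    simpa using congrArg (fun α : Fin n → ℕ => ∑ i, α i) e
  simp [nf, h, e0, e1, e2, h2, h1]

theorem HasPBWBasis.centralCoeffs (h : P.HasPBWBasis 1) : P.CentralCoeffs := fun i j hij =>
  ⟨fun k => by rw [← nf_apply_single (P := P) hij k]; exact nf_mem_center h i j _,
    by rw [← nf_apply_zero (P := P) hij]; exact nf_mem_center h i j _⟩

/-- Both ways of rewriting `x_k x_j x_i` compute the same element of the algebra. -/
theorem HasPBWBasis.coeffsAgree (h : P.HasPBWBasis 1) : P.CoeffsAgree := by
  intro i j k hij hjk α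
  have hF := P.wordProd_eq_rewrite
  have hl := rewrite_left (P := P) (i := i) (j := j) (k := k) P.wordProd_pair
    (by simpa using hF [j] (hij.trans hjk) []) (by simpa using hF [] hij [k])
  have hr := rewrite_right (P := P) hij hjk P.wordProd_pair
    (by simpa using hF [] (hij.trans hjk) [j]) (by simpa using hF [i] hjk [])
  have e1 := hF [] hjk [i]
  have e2 := hF [k] hij []
  simp only [List.nil_append, List.append_nil, List.cons_append] at e1 e2
  have e := hl.symm.trans (e1.symm.trans (e2.trans hr))
  rw [evalOrdered_injective h (add_left_cancel e)]

/-! ### Reordering the variables -/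

theorem x_mul_mem_degLT {m : ℕ} (i : Fin n) {u : P.Alg} (hu : u ∈ P.degLT m) :
    P.x i * u ∈ P.degLT (m + 1) := by
  induction hu using Submodule.span_induction with
  | mem s hs =>
    obtain ⟨α, hα, rfl⟩ := hs
    rw [mono_eq_wordProd, ← wordProd_cons]
    refine P.wordProd_mem_degLT _ ?_
    rw [List.length_cons, length_expWord]
    exact Nat.succ_lt_succ hα
  | zero => simp
  | add s t _ _ hs ht => rw [mul_add]; exact add_mem hs ht
  | smul d s _ hs => rw [x_mul_smul]; exact Submodule.smul_mem _ d hs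

theorem swap_sub_mem_degLT {i j : Fin n} (h : j < i) (w : List (Fin n)) :
    P.wordProd (i :: j :: w) - P.q i j • P.wordProd (j :: i :: w) ∈ P.degLT (w.length + 2) := by
  have e := P.wordProd_eq_rewrite [] h w
  simp only [List.nil_append, List.cons_append, rewrite] at e
  rw [e, add_assoc, add_sub_cancel_left]
  exact add_mem (sum_mem fun l _ => Submodule.smul_mem _ _ (P.wordProd_mem_degLT _ (by simp)))
    (Submodule.smul_mem _ _ (P.wordProd_mem_degLT _ (by simp)))

/-- If all `q_{ij}` are units then words with the same letters agree up to a unit and terms of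
lower degree. -/
theorem exists_unit_of_perm (hq : ∀ i j : Fin n, j < i → IsUnit (P.q i j))
    {w w' : List (Fin n)} (h : w.Perm w') :
    ∃ c : Dˣ, P.wordProd w - (c : D) • P.wordProd w' ∈ P.degLT w.length := by
  induction h with
  | nil => exact ⟨1, by simp⟩
  | cons i _ ih =>
    obtain ⟨c, hc⟩ := ih
    refine ⟨c, ?_⟩
    rw [wordProd_cons, wordProd_cons, ← x_mul_smul, ← mul_sub]
    exact x_mul_mem_degLT i hc
  | swap i j w =>
    rcases lt_trichotomy i j with h | rfl | h
    · obtain ⟨c, hc⟩ := hq j i h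
      exact ⟨c, hc ▸ swap_sub_mem_degLT h w⟩
    · exact ⟨1, by simp⟩
    · obtain ⟨c, hc⟩ := hq i j h
      refine ⟨c⁻¹, ?_⟩
      have := Submodule.smul_mem _ (-(↑c⁻¹ : D)) (swap_sub_mem_degLT (P := P) h w)
      rw [← hc, smul_sub, smul_smul, neg_mul, Units.inv_mul, neg_smul, neg_smul, one_smul,
        sub_neg_eq_add, neg_add_eq_sub] at this
      exact this
  | trans h _ ih ih' =>
    obtain ⟨c, hc⟩ := ih
    obtain ⟨c', hc'⟩ := ih'
    refine ⟨c * c', ?_⟩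
    rw [← h.length_eq] at hc'
    have := add_mem hc (Submodule.smul_mem _ (c : D) hc')
    rwa [smul_sub, smul_smul, sub_add_sub_cancel] at this

theorem expWord_perm (σ : Equiv.Perm (Fin n)) (β : Fin n → ℕ) :
    (expWord σ (β ∘ σ)).Perm (expWord 1 β) := by
  rw [List.perm_iff_count]
  intro i
  obtain ⟨k, rfl⟩ := σ.surjective i
  rw [count_expWord]
  exact (count_expWord 1 β (σ k)).symm

/-- The monomials are indexed through `β ↦ β ∘ σ` so that `x_σ^{β ∘ σ}` and `x^β` have the same
letters. -/
theorem exists_unit_mono (hq : ∀ i j : Fin n, j < i → IsUnit (P.q i j))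
    (σ : Equiv.Perm (Fin n)) (β : Fin n → ℕ) :
    ∃ c : Dˣ, P.mono σ (β ∘ σ) - (c : D) • P.mono 1 β ∈ P.degLT (∑ i, β i) := by
  rw [mono_eq_wordProd, mono_eq_wordProd, ← length_expWord 1, ← (expWord_perm σ β).length_eq]
  exact exists_unit_of_perm hq (expWord_perm σ β)

/-- A family `v` that is triangular, with units on the diagonal, with respect to a basis graded by
degree is itself a basis. -/
theorem basis_of_triangular {ι M : Type*} [AddCommGroup M] [Module D M] (deg : ι → ℕ)
    {e v : ι → M} (he : LinearIndependent D e) (hs : Submodule.span D (Set.range e) = ⊤)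
    (h : ∀ i, ∃ c : Dˣ, v i - (c : D) • e i ∈ Submodule.span D (e '' {j | deg j < deg i})) :
    LinearIndependent D v ∧ Submodule.span D (Set.range v) = ⊤ := by
  classical
  choose c hc using h
  constructor
  · rw [linearIndependent_iff]
    intro l hl
    by_contra hne
    obtain ⟨i, hi, hmax⟩ := l.support.exists_max_image deg (Finsupp.support_nonempty_iff.mpr hne)
    -- the coefficient of `e i` in the combination `∑ l j • v j`, for `i` of maximal degree
    let b := Module.Basis.mk he hs.ge
    have hlow : ∀ j, ∀ m ∈ Submodule.span D (e '' {k | deg k < deg j}), deg j ≤ deg i →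
        b.repr m i = 0 := by
      intro j m hm hj
      induction hm using Submodule.span_induction with
      | mem m hm =>
        obtain ⟨k, hk, rfl⟩ := hm
        have hki : k ≠ i := fun e => absurd (e ▸ hk : deg i < deg j) (not_lt.mpr hj)
        have : e k = b k := (Module.Basis.mk_apply he hs.ge k).symm
        rw [this, b.repr_self, Finsupp.single_eq_of_ne hki.symm]
      | zero => simp
      | add _ _ _ _ h h' => simp [h, h']
      | smul d _ _ h => simp [h]
    have hv : ∀ j ∈ l.support, b.repr (v j) i = if j = i then (c i : D) else 0 := by
      intro j hj
      have e1 := hlow j _ (hc j) (hmax j hj)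
      have : e j = b j := (Module.Basis.mk_apply he hs.ge j).symm
      rw [this, map_sub, Finsupp.sub_apply, sub_eq_zero, map_smul, b.repr_self,
        Finsupp.smul_apply, Finsupp.single_apply] at e1
      rw [e1]
      split_ifs with hji
      · simp [hji]
      · simp
    have h0 : b.repr (Finsupp.linearCombination D v l) i = l i * c i := by
      rw [Finsupp.linearCombination_apply, Finsupp.sum, map_sum, Finsupp.finsetSum_apply,
        Finset.sum_eq_single i]
      · simp [hv i hi]
      · intro j hj hji
        simp [hv j hj, hji]
      · intro hi'; exact absurd hi hi'
    rw [hl, map_zero, Finsupp.zero_apply, eq_comm, Units.mul_left_eq_zero] at h0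
    exact (Finsupp.mem_support_iff.mp hi) h0
  · rw [eq_top_iff, ← hs, Submodule.span_le]
    rintro _ ⟨i, rfl⟩
    induction hd : deg i using Nat.strong_induction_on generalizing i with
    | _ d ih =>
      subst hd
      have hle : Submodule.span D (e '' {j | deg j < deg i}) ≤ Submodule.span D (Set.range v) := by
        rw [Submodule.span_le]
        rintro _ ⟨j, hj, rfl⟩
        exact ih _ hj j rfl
      have h1 : (c i : D) • e i ∈ Submodule.span D (Set.range v) := by
        have := sub_mem (Submodule.subset_span (Set.mem_range_self i)) (hle (hc i))
        rwa [sub_sub_cancel] at this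
      have h2 := Submodule.smul_mem _ (↑(c i)⁻¹ : D) h1
      rwa [smul_smul, Units.inv_mul, one_smul] at h2

theorem HasPBWBasis.of_isUnit (h : P.HasPBWBasis 1)
    (hq : ∀ i j : Fin n, j < i → IsUnit (P.q i j)) (σ : Equiv.Perm (Fin n)) :
    P.HasPBWBasis σ := by
  let τ : (Fin n → ℕ) ≃ (Fin n → ℕ) := σ.symm.arrowCongr (Equiv.refl ℕ)
  have hτ : P.mono σ ∘ τ = fun β => P.mono σ (β ∘ σ) := rfl
  have key := basis_of_triangular (fun β : Fin n → ℕ => ∑ i, β i) h.1 h.2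
    (exists_unit_mono hq σ)
  rw [← hτ, linearIndependent_equiv, τ.surjective.range_comp] at key
  exact key

end BiquadraticData

theorem theorem1p1 {D : Type*} [Ring D] [Nontrivial D] (n : ℕ) (hn : 3 ≤ n)
    (P : BiquadraticData D n) :
    ((Nontrivial P.Alg ∧ P.HasPBWBasis 1) ↔ (P.CentralCoeffs ∧ P.CoeffsAgree)) ∧
      (P.CentralCoeffs → P.CoeffsAgree → (∀ i j : Fin n, j < i → IsUnit (P.q i j)) →
        ∀ σ : Equiv.Perm (Fin n), P.HasPBWBasis σ) := by
  refine ⟨⟨fun h => ⟨h.2.centralCoeffs, h.2.coeffsAgree⟩, fun ⟨hP, hc⟩ => ?_⟩,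
    fun hP hc hq σ => (BiquadraticData.hasPBWBasis_one hP hc).of_isUnit hq σ⟩
  have h := BiquadraticData.hasPBWBasis_one hP hc
  exact ⟨⟨P.mono 1 0, 0, h.1.ne_zero 0⟩, h⟩
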